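/- Let $d\ge 2$, let $N_1,\dots,N_d$ be positive integers, and let $\mathcal B$ be a complex $d$-way tensor with entries $\mathcal B(j_1,\dots,j_d)$, $|j_i|\le N_i-1$. Index rows and columns by multi-indices, and let $T$ be the $d$-level block Toeplitz matrix of size $\prod_i N_i$ with entries $T(m,n)=\mathcal B(m_1-n_1,\dots,m_d-n_d)$, $1\le m_i,n_i\le N_i$. Assume that $r:=\operatorname{rank}T<\min_i N_i$. For each $i$ let $f_{L,i},f_{H,i}\in[0,1)$, and put $\mathbb F_i=[f_{L,i},f_{H,i}]$ if $f_{L,i}<f_{H,i}$ and $\mathbb F_i=[0,1)\setminus(f_{H,i},f_{L,i})$ otherwise (so $\mathbb F_i=[0,1)$ if $f_{L,i}=f_{H,i}$). With $s_i=\operatorname{sign}(f_{H,i}-f_{L,i})$, let $g_i(x)=r_{1,i}x^{-1}+r_{0,i}+r_{-1,i}x$ be given by $$r_{0,i}=-2\cos\big(\pi(f_{H,i}-f_{L,i})\big)\,s_i,\qquad r_{1,i}=e^{\mathrm i\pi(f_{L,i}+f_{H,i})}\,s_i,\qquad r_{-1,i}=\overline{r_{1,i}},$$ and let $T_{g_i}$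 be the block Toeplitz matrix of size $\prod_l (N_l-1)$ with entries $$T_{g_i}(m,n)=\sum_{k=-1}^{1}r_{k,i}\,\mathcal B(m_1-n_1,\dots,m_i-n_i-k,\dots,m_d-n_d),\qquad 1\le m_l,n_l\le N_l-1.$$ For $f\in[0,1)^d$ let $a(f)$ be the vector with entries $a(f)_m=\prod_{i=1}^d e^{\mathrm i2\pi(m_i-1)f_i}$, $1\le m_i\le N_i$. Then the following are equivalent: 1. there are real numbers $\sigma_1,\dots,\sigma_r>0$ and pairwise distinct $f_1,\dots,f_r\in[0,1)^d$, $f_\ell=(f_{1,\ell},\dots,f_{d,\ell})$, such that $T=\sum_{\ell=1}^r\sigma_\ell\,a(f_\ell)a(f_\ell)^H$ and $f_{i,\ell}\in\mathbb F_i$ for all $\ell=1,\dots,r$ and $i=1,\dots,d$; 2. $T$ is positive semidefinite and $T_{g_i}$ is positive semidefinite for every $i=1,\dots,d$. -/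

import Mathlib

open scoped ComplexOrder

noncomputable section

namespace MDFS

/-- The multi-level index set `{0, …, N₁-1} × ⋯ × {0, …, N_d-1}` of size `∏ i, N i`, which labels
the rows and columns of a `d`-level matrix. -/
abbrev Idx {d : ℕ} (N : Fin d → ℕ) : Type := (i : Fin d) → Fin (N i)

/-- The lag `(m₁ - n₁, …, m_d - n_d)` of two multi-indices. -/
def lag {d : ℕ} {N : Fin d → ℕ} (m n : Idx N) : Fin d → ℤ :=
  fun i => ((m i : ℕ) : ℤ) - ((n i : ℕ) : ℤ)

/-- The `d`-level block Toeplitz matrix of a `d`-way tensor `B`, of size `∏ N i`. The tensor is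
written as a function of integer lags; only the entries with `|j i| ≤ N i - 1` for all `i`
(a `(2 N₁ - 1) × ⋯ × (2 N_d - 1)` tensor) occur. -/
def blockToeplitz {d : ℕ} (N : Fin d → ℕ) (B : (Fin d → ℤ) → ℂ) :
    Matrix (Idx N) (Idx N) ℂ :=
  Matrix.of fun m n => B (lag m n)

/-- A Hermitian trigonometric polynomial of degree one,
`g(x) = r₁ x⁻¹ + r₀ + r₋₁ x` with `r₀` real and `r₋₁ = conj r₁`, given by `r₀` and `r₁`. -/
structure HermitianTrigPoly where
  r0 : ℝ
  r1 : ℂ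

/-- The coefficient `r_k`, that is, the coefficient of `x ^ (-k)`. -/
def HermitianTrigPoly.coeff (g : HermitianTrigPoly) (k : ℤ) : ℂ :=
  if k = 1 then g.r1
  else if k = 0 then (g.r0 : ℂ)
  else if k = -1 then (starRingEnd ℂ) g.r1
  else 0

/-- The block Toeplitz matrix `T_g` of size `∏ (N i - 1)`, obtained from the tensor `B` and the
polynomial `g` acting in the `i`-th dimension:
`T_g(m, n) = ∑_{k=-1}^{1} r_k B(m₁ - n₁, …, m_i - n_i - k, …, m_d - n_d)`.
Only entries of `B` with lags `|j l| ≤ N l - 1` occur here as well. -/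
def derivedToeplitz {d : ℕ} (N : Fin d → ℕ) (B : (Fin d → ℤ) → ℂ) (g : HermitianTrigPoly)
    (i : Fin d) :
    Matrix (Idx fun j => N j - 1) (Idx fun j => N j - 1) ℂ :=
  Matrix.of fun m n => ∑ k ∈ Finset.Icc (-1 : ℤ) 1, g.coeff k * B (lag m n - Pi.single i k)

/-- The complex sinusoid `(1, e^{i2πf}, …, e^{i2π(N-1)f})`. -/
def sinusoid (f : ℝ) (N : ℕ) : Fin N → ℂ :=
  fun m => Complex.exp (Complex.I * 2 * Real.pi * (m : ℕ) * f)

/-- The vectorized `d`-dimensional sinusoid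
`a(f) = vec (s(f₁, N₁) ⊗ ⋯ ⊗ s(f_d, N_d))`, indexed by multi-indices. -/
def atom {d : ℕ} (N : Fin d → ℕ) (f : Fin d → ℝ) : Idx N → ℂ :=
  fun m => ∏ i, sinusoid (f i) (N i) (m i)

/-- The frequency interval `[fL, fH]` in `[0,1)`: the usual closed interval if `fL < fH`, and
`[0,1) \ (fH, fL)` otherwise (in particular all of `[0,1)` if `fL = fH`). -/
def freqInterval (fL fH : ℝ) : Set ℝ :=
  if fL < fH then Set.Icc fL fH else Set.Ico 0 1 \ Set.Ioo fH fL

/-- The degree-one Hermitian trigonometric polynomial attached to the interval `[fL, fH]`: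
`r₀ = -2 cos(π (fH - fL)) sign(fH - fL)` and `r₁ = e^{iπ(fL + fH)} sign(fH - fL)`. -/
def intervalPoly (fL fH : ℝ) : HermitianTrigPoly where
  r0 := -2 * Real.cos (Real.pi * (fH - fL)) * Real.sign (fH - fL)
  r1 := Complex.exp (Complex.I * Real.pi * (fL + fH)) * (Real.sign (fH - fL) : ℂ)

/-- `T = ∑ ℓ, σ ℓ • a(f ℓ) a(f ℓ)ᴴ` with weights `σ ℓ > 0` and pairwise distinct frequency vectors
`f ℓ ∈ [0,1)^d`. -/
structure IsVandermondeDecomposition {d : ℕ} (N : Fin d → ℕ) (T : Matrix (Idx N) (Idx N) ℂ)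
    {r : ℕ} (σ : Fin r → ℝ) (f : Fin r → Fin d → ℝ) : Prop where
  pos : ∀ l, 0 < σ l
  mem_unit : ∀ l i, f l i ∈ Set.Ico (0 : ℝ) 1
  distinct : Function.Injective f
  eq_sum : T = ∑ l, (σ l : ℂ) • Matrix.vecMulVec (atom N (f l)) (star (atom N (f l)))

end MDFS

end

/-!
A Vandermonde decomposition turns both matrices into combinations of atoms: the block Toeplitz
matrix is `∑ σ_l a(f_l) a(f_l)ᴴ`, and the derived matrix in direction `i` is
`∑ σ_l g_i(e^{i2π f_{i,l}}) a'(f_l) a'(f_l)ᴴ` with the atoms `a'` of size `∏ (N j - 1)`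
(`derivedToeplitz_eq_sum`). Since `r ≤ N j - 1` for all `j`, the shortened atoms are still linearly
independent, as multivariate interpolation shows (`exists_dual_vector`). Hence the derived matrix is
positive semidefinite if and only if all its weights are nonnegative
(`posSemidef_sum_of_nonneg`, `nonneg_of_posSemidef_sum`). On the unit circle `g_i` equals
`4 sign(f_H - f_L) sin(π (f_H - t)) sin(π (t - f_L))`, which is nonnegative exactly on the frequency
interval (`intervalPoly_value_nonneg_iff`).

It remains to decompose a positive semidefinite block Toeplitz matrix `T` of rank `r < min N i`
(`exists_vandermondeDecomposition`). Write `T` as the Gram matrix of vectors `v m` spanning a space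
`E` of dimension `r`. The Toeplitz structure says that unit shifts of the index preserve inner
products. As `r < N i`, the vectors with `m i < N i - 1` already span `E`: the spans of the first
`k` levels stabilise by dimension count, and the stabilisation propagates by shift invariance
(`top_level_mem_span`). So each shift extends to an isometry of `E`. Two of these isometries commute,
because the vectors on which both may act also span, by the same argument applied to a box shortened
in one direction. Commuting isometries are simultaneously diagonalisable with orthogonal joint
eigenspaces (`iSup_iInf_eigenspace_eq_top`). Splitting `v 0` into its joint eigencomponents writes
`T` as a positive combination of distinct characters (`exists_character_decomposition`). The
components are orthogonal, nonzero, and span `E`, so there are exactly `r` of them.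
-/

open scoped ComplexOrder

namespace MDFS

/-! ### Families with equal Gram matrices -/

section Gram

variable {ι E : Type*} [NormedAddCommGroup E] [InnerProductSpace ℂ E]

/-- The norm of a linear combination depends only on the Gram matrix of the family. -/
theorem norm_linearCombination_eq_of_gram_eq {x y : ι → E}
    (h : ∀ a b, inner ℂ (x a) (x b) = inner ℂ (y a) (y b)) (c : ι →₀ ℂ) :
    ‖Finsupp.linearCombination ℂ x c‖ = ‖Finsupp.linearCombination ℂ y c‖ := by
  have key : inner ℂ (Finsupp.linearCombination ℂ x c) (Finsupp.linearCombination ℂ x c) =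
      inner ℂ (Finsupp.linearCombination ℂ y c) (Finsupp.linearCombination ℂ y c) := by
    simp only [Finsupp.linearCombination_apply, Finsupp.sum, sum_inner, inner_sum,
      inner_smul_left, inner_smul_right, h]
  rw [@norm_eq_sqrt_re_inner ℂ, @norm_eq_sqrt_re_inner ℂ, key]

/-- A linear relation between vectors is read off from their Gram matrix. -/
theorem mem_span_image_of_gram_eq {x y : ι → E}
    (h : ∀ a b, inner ℂ (x a) (x b) = inner ℂ (y a) (y b)) {s : Set ι} {a : ι}
    (ha : x a ∈ Submodule.span ℂ (x '' s)) : y a ∈ Submodule.span ℂ (y '' s) := by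
  rw [Finsupp.mem_span_image_iff_linearCombination] at ha ⊢
  obtain ⟨c, hc, hca⟩ := ha
  refine ⟨c, hc, ?_⟩
  have := norm_linearCombination_eq_of_gram_eq h (c - Finsupp.single a 1)
  rw [map_sub, map_sub, hca, Finsupp.linearCombination_single,
    Finsupp.linearCombination_single] at this
  simpa [sub_eq_zero] using this.symm

/-- A spanning family is carried by a linear isometry onto any family with the same Gram matrix. -/
theorem exists_linearIsometry_of_gram_eq {x y : ι → E}
    (h : ∀ a b, inner ℂ (x a) (x b) = inner ℂ (y a) (y b))
    (hx : Submodule.span ℂ (Set.range x) = ⊤) : ∃ S : E →ₗᵢ[ℂ] E, ∀ a, S (x a) = y a := by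
  obtain ⟨g, hg⟩ := (Finsupp.linearCombination ℂ x).exists_rightInverse_of_surjective
    (by rw [Finsupp.range_linearCombination, hx])
  have hg' : ∀ e, Finsupp.linearCombination ℂ x (g e) = e := fun e => LinearMap.congr_fun hg e
  refine ⟨⟨Finsupp.linearCombination ℂ y ∘ₗ g, fun e => ?_⟩, fun a => ?_⟩
  · rw [LinearMap.comp_apply, ← norm_linearCombination_eq_of_gram_eq h, hg']
  · have := norm_linearCombination_eq_of_gram_eq h (g (x a) - Finsupp.single a 1)
    rw [map_sub, map_sub, hg', Finsupp.linearCombination_single,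
      Finsupp.linearCombination_single] at this
    simpa [sub_eq_zero] using this.symm

/-- For a one-level block Toeplitz Gram matrix with more levels than the dimension of the space,
the top level lies in the span of the lower ones: the spans of the first `k` levels stabilise
for some `k ≤ p` by dimension count, and shift invariance propagates the stabilisation upwards. -/
theorem top_level_mem_span [FiniteDimensional ℂ E] {κ : Type*} {p : ℕ}
    (hp : Module.finrank ℂ E ≤ p) (w : ℕ → κ → E)
    (hw : ∀ k < p, ∀ l < p, ∀ a b,
      inner ℂ (w (k + 1) a) (w (l + 1) b) = inner ℂ (w k a) (w l b)) (a : κ) :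
    w p a ∈ Submodule.span ℂ {e | ∃ l < p, ∃ b, w l b = e} := by
  let W : ℕ → Submodule ℂ E := fun k => Submodule.span ℂ {e | ∃ l < k, ∃ b, w l b = e}
  have hmono : ∀ k, W k ≤ W (k + 1) := fun k => Submodule.span_mono fun e ⟨l, hl, b, hb⟩ =>
    ⟨l, by omega, b, hb⟩
  have hstall : ∃ k ≤ p, W k = W (k + 1) := by
    by_contra! hne
    have : ∀ k ≤ p + 1, k ≤ Module.finrank ℂ (W k) := by
      intro k
      induction k with
      | zero => simp
      | succ k ih =>
        intro hk
        have := Submodule.finrank_lt_finrank_of_lt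
          (lt_of_le_of_ne (hmono k) (hne k (by omega)))
        have := ih (by omega)
        omega
    have h1 := this (p + 1) le_rfl
    have h2 := Submodule.finrank_le (W (p + 1))
    omega
  obtain ⟨k, hk, hkW⟩ := hstall
  have hprop : ∀ j, k ≤ j → j ≤ p → W (j + 1) ≤ W j := by
    intro j hj
    induction j, hj using Nat.le_induction with
    | base => exact fun _ => hkW.ge
    | succ j _ ih =>
      intro hjp
      refine Submodule.span_le.2 ?_
      rintro _ ⟨l, hl, b, rfl⟩
      rcases Nat.lt_succ_iff_lt_or_eq.1 hl with hl | rfl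
      · exact Submodule.subset_span ⟨l, hl, b, rfl⟩
      have hmem : w j b ∈ W j := ih (by omega) (Submodule.subset_span ⟨j, by omega, b, rfl⟩)
      -- `y` is the family `x` moved up by one level; the two have the same Gram matrix.
      let x : {k // k < p} × κ → E := fun q => w q.1 q.2
      let y : {k // k < p} × κ → E := fun q => w (q.1 + 1) q.2
      have hx : x (⟨j, by omega⟩, b) ∈ Submodule.span ℂ (x '' {q | (q.1 : ℕ) < j}) := by
        refine Submodule.span_mono ?_ hmem
        rintro _ ⟨l, hl, c, rfl⟩
        exact ⟨(⟨l, by omega⟩, c), hl, rfl⟩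
      have hy := mem_span_image_of_gram_eq (y := y)
        (fun q q' => (hw q.1 q.1.2 q'.1 q'.1.2 q.2 q'.2).symm) hx
      refine Submodule.span_mono ?_ hy
      rintro _ ⟨q, hq, rfl⟩
      exact ⟨q.1 + 1, Nat.succ_lt_succ hq, q.2, rfl⟩
  exact hprop p hk le_rfl (Submodule.subset_span ⟨p, by omega, a, rfl⟩)

end Gram

/-! ### Joint diagonalisation of commuting isometries -/

section Isometries

variable {ι E : Type*} [NormedAddCommGroup E] [InnerProductSpace ℂ E]

open Module.End

theorem norm_eigenvalue_linearIsometry {S : E →ₗᵢ[ℂ] E} {μ : ℂ} {u : E} (hu : u ≠ 0)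
    (h : S u = μ • u) : ‖μ‖ = 1 := by
  have := S.norm_map u
  rw [h, norm_smul] at this
  exact (mul_eq_right₀ (norm_ne_zero_iff.2 hu)).1 this

theorem inner_eq_zero_of_eigenvalue_ne {S : E →ₗᵢ[ℂ] E} {μ ν : ℂ} {u w : E}
    (hu : S u = μ • u) (hw : S w = ν • w) (hμν : μ ≠ ν) : inner ℂ u w = 0 := by
  by_contra hne
  have hμ := norm_eigenvalue_linearIsometry (fun h => hne (by simp [h])) hu
  have h := S.inner_map_map u w
  rw [hu, hw, inner_smul_left, inner_smul_right, ← mul_assoc] at h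
  have h1 : (starRingEnd ℂ) μ * ν = 1 := (mul_eq_right₀ hne).1 h
  apply hμν
  calc μ = μ * ((starRingEnd ℂ) μ * ν) := by rw [h1, mul_one]
    _ = ν := by rw [← mul_assoc, Complex.mul_conj']; simp [hμ]

/-- An isometry of a finite-dimensional space is semisimple: the orthogonal complement of an
invariant subspace is invariant. -/
theorem isSemisimple_linearIsometry [FiniteDimensional ℂ E] (S : E →ₗᵢ[ℂ] E) :
    IsSemisimple (S.toLinearMap : Module.End ℂ E) := by
  rw [isSemisimple_iff]
  intro p hp
  have hp' : p.map S.toLinearMap ≤ p := Submodule.map_le_iff_le_comap.2 hp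
  have hpp : p.map S.toLinearMap = p := Submodule.eq_of_le_of_finrank_eq hp'
    (Submodule.equivMapOfInjective S.toLinearMap S.injective p).finrank_eq.symm
  refine ⟨pᗮ, ?_, Submodule.isCompl_orthogonal _⟩
  intro u hu
  rw [Submodule.mem_comap, Submodule.mem_orthogonal]
  intro z hz
  rw [← hpp] at hz
  obtain ⟨z', hz', rfl⟩ := hz
  exact (S.inner_map_map z' u).trans ((Submodule.mem_orthogonal _ _).1 hu z' hz')

/-- Commuting isometries of a finite-dimensional space are simultaneously diagonalisable. -/
theorem iSup_iInf_eigenspace_eq_top [FiniteDimensional ℂ E] (S : ι → E →ₗᵢ[ℂ] E)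
    (hS : ∀ i j e, S i (S j e) = S j (S i e)) :
    ⨆ χ : ι → ℂ, ⨅ i, eigenspace (S i).toLinearMap (χ i) = ⊤ := by
  have hmax : ∀ i μ, maxGenEigenspace (S i).toLinearMap μ = eigenspace (S i).toLinearMap μ :=
    fun i μ =>
      (isSemisimple_linearIsometry (S i)).isFinitelySemisimple.maxGenEigenspace_eq_eigenspace μ
  have := iSup_iInf_maxGenEigenspace_eq_top_of_iSup_maxGenEigenspace_eq_top_of_commute
    (fun i => ((S i).toLinearMap : Module.End ℂ E))
    (fun i j _ => LinearMap.ext fun e => hS i j e)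
    (fun i => iSup_maxGenEigenspace_eq_top _)
  simpa only [hmax] using this

end Isometries

/-! ### Multilevel Toeplitz Gram matrices -/

section Box

variable {d : ℕ}

/-- The box `∏ i, {0, …, N i - 1}` inside the lattice `ℕ ^ d`. -/
def box (N : Fin d → ℕ) : Set (Fin d → ℕ) := {m | ∀ i, m i < N i}

variable {E : Type*} [NormedAddCommGroup E] [InnerProductSpace ℂ E]

/-- The Gram matrix of the family `v` is invariant under the unit shifts that stay in the box:
it is a multilevel block Toeplitz matrix. -/
def ShiftInvariantGram (N : Fin d → ℕ) (v : (Fin d → ℕ) → E) : Prop :=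
  ∀ i m n, m + Pi.single i 1 ∈ box N → n + Pi.single i 1 ∈ box N →
    inner ℂ (v (m + Pi.single i 1)) (v (n + Pi.single i 1)) = inner ℂ (v m) (v n)

theorem box_mono {N N' : Fin d → ℕ} (h : ∀ i, N i ≤ N' i) : box N ⊆ box N' :=
  fun _ hm i => (hm i).trans_le (h i)

theorem ShiftInvariantGram.mono {N N' : Fin d → ℕ} {v : (Fin d → ℕ) → E}
    (hv : ShiftInvariantGram N' v) (h : ∀ i, N i ≤ N' i) : ShiftInvariantGram N v :=
  fun i m n hm hn => hv i m n (box_mono h hm) (box_mono h hn)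

theorem mem_box_of_add {N : Fin d → ℕ} {m e : Fin d → ℕ} (h : m + e ∈ box N) : m ∈ box N :=
  fun i => (Nat.le_add_right _ _).trans_lt (h i)

theorem update_pred_le (N : Fin d → ℕ) (i j : Fin d) :
    Function.update N i (N i - 1) j ≤ N j := by
  rcases eq_or_ne j i with rfl | hj
  · simp
  · simp [hj]

theorem add_single_mem_box {N : Fin d → ℕ} {i : Fin d} {m : Fin d → ℕ}
    (hm : m ∈ box (Function.update N i (N i - 1))) : m + Pi.single i 1 ∈ box N := by
  intro j
  have := hm j
  rcases eq_or_ne j i with rfl | hj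
  · simp at this ⊢; omega
  · simpa [hj] using this

/-- Deleting the last slice of the box in direction `i` does not change the span. -/
theorem span_box_le_span_box_update [FiniteDimensional ℂ E] {N : Fin d → ℕ}
    {v : (Fin d → ℕ) → E} (hv : ShiftInvariantGram N v) (i : Fin d)
    (hN : Module.finrank ℂ E < N i) :
    Submodule.span ℂ (v '' box N) ≤
      Submodule.span ℂ (v '' box (Function.update N i (N i - 1))) := by
  obtain ⟨p, hp⟩ : ∃ p, N i = p + 1 := ⟨N i - 1, by omega⟩
  have hshift : ∀ (a : Fin d → ℕ) k, Function.update a i (k + 1) =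
      Function.update a i k + Pi.single i 1 := by
    intro a k
    ext j
    rcases eq_or_ne j i with rfl | hj
    · simp
    · simp [hj]
  have hmem : ∀ (a : box N) k, k < p → Function.update a.1 i (k + 1) ∈ box N := by
    intro a k hk j
    rcases eq_or_ne j i with rfl | hj
    · simp; omega
    · simpa [hj] using a.2 j
  have hmem' : ∀ (a : box N) k, k < p →
      Function.update a.1 i k ∈ box (Function.update N i (N i - 1)) := by
    intro a k hk j
    rcases eq_or_ne j i with rfl | hj
    · simp; omega
    · simpa [hj] using a.2 j
  rw [Submodule.span_le]
  rintro _ ⟨m, hm, rfl⟩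
  have hmi := hm i
  rcases Nat.lt_or_ge (m i) p with hlt | hge
  · refine Submodule.subset_span ⟨m, ?_, rfl⟩
    have := hmem' ⟨m, hm⟩ (m i) hlt
    rwa [Function.update_eq_self] at this
  · have key := top_level_mem_span (p := p) (by omega)
      (fun k (a : box N) => v (Function.update a.1 i k))
      (fun k hk l hl a b => by
        simp only [hshift]
        exact hv i _ _ (hshift a.1 k ▸ hmem a k hk) (hshift b.1 l ▸ hmem b l hl)) ⟨m, hm⟩
    have hmp : m i = p := by omega
    simp only [← hmp, Function.update_eq_self] at key
    refine Submodule.span_mono ?_ key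
    rintro _ ⟨l, hl, b, rfl⟩
    exact ⟨_, hmem' b l (by omega), rfl⟩

/-- The shift in direction `i` extends to an isometry of the whole space. -/
theorem exists_shift_isometry [FiniteDimensional ℂ E] {N : Fin d → ℕ} {v : (Fin d → ℕ) → E}
    (hv : ShiftInvariantGram N v) (hspan : Submodule.span ℂ (v '' box N) = ⊤)
    (i : Fin d) (hN : Module.finrank ℂ E < N i) :
    ∃ S : E →ₗᵢ[ℂ] E, ∀ m, m + Pi.single i 1 ∈ box N → S (v m) = v (m + Pi.single i 1) := by
  obtain ⟨S, hS⟩ := exists_linearIsometry_of_gram_eq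
    (x := fun m : {m : Fin d → ℕ // m + Pi.single i 1 ∈ box N} => v m)
    (y := fun m => v (m.1 + Pi.single i 1))
    (fun a b => (hv i _ _ a.2 b.2).symm) (by
      rw [eq_top_iff, ← hspan]
      refine (span_box_le_span_box_update hv i hN).trans (Submodule.span_mono ?_)
      rintro _ ⟨m, hm, rfl⟩
      exact ⟨⟨m, add_single_mem_box hm⟩, rfl⟩)
  exact ⟨S, fun m hm => hS ⟨m, hm⟩⟩

/-- The shift isometries in two directions commute, because the vectors on which both may be
applied in turn already span. -/
theorem shift_isometries_commute [FiniteDimensional ℂ E] {N : Fin d → ℕ} {v : (Fin d → ℕ) → E}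
    (hv : ShiftInvariantGram N v) (hspan : Submodule.span ℂ (v '' box N) = ⊤)
    (hN : ∀ i, Module.finrank ℂ E < N i) {S : Fin d → E →ₗᵢ[ℂ] E}
    (hS : ∀ i m, m + Pi.single i 1 ∈ box N → S i (v m) = v (m + Pi.single i 1))
    (i j : Fin d) (e : E) : S i (S j e) = S j (S i e) := by
  rcases eq_or_ne i j with rfl | hij
  · rfl
  set N' := Function.update N i (N i - 1)
  have hNj : N' j = N j := Function.update_of_ne hij.symm _ _
  have hle : (⊤ : Submodule ℂ E) ≤
      Submodule.span ℂ (v '' box (Function.update N' j (N' j - 1))) := by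
    rw [← hspan]
    refine (span_box_le_span_box_update hv i (hN i)).trans ?_
    exact span_box_le_span_box_update (hv.mono (update_pred_le N i)) j
      ((hN j).trans_eq hNj.symm)
  have hext : (S i).toLinearMap ∘ₗ (S j).toLinearMap = (S j).toLinearMap ∘ₗ (S i).toLinearMap := by
    refine LinearMap.ext_on (eq_top_iff.2 hle) ?_
    rintro _ ⟨m, hm, rfl⟩
    have hmj : m + Pi.single j 1 ∈ box N' := add_single_mem_box hm
    have hmji : m + Pi.single j 1 + Pi.single i 1 ∈ box N := add_single_mem_box hmj
    have hmij : m + Pi.single i 1 + Pi.single j 1 ∈ box N := by rwa [add_right_comm]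
    change S i (S j (v m)) = S j (S i (v m))
    rw [hS j m (mem_box_of_add hmji), hS i _ hmji, hS i m (mem_box_of_add hmij), hS j _ hmij,
      add_right_comm]
  exact LinearMap.congr_fun hext e

/-- A multilevel Toeplitz Gram matrix whose rank is smaller than each side of the box is a
positive combination of `rank` many distinct characters of the lattice. -/
theorem exists_character_decomposition [FiniteDimensional ℂ E] {N : Fin d → ℕ}
    {v : (Fin d → ℕ) → E} (hv : ShiftInvariantGram N v)
    (hspan : Submodule.span ℂ (v '' box N) = ⊤) (hN : ∀ i, Module.finrank ℂ E < N i) :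
    ∃ (s : Finset (Fin d → ℂ)) (c : (Fin d → ℂ) → ℝ), s.card = Module.finrank ℂ E ∧
      (∀ χ ∈ s, 0 < c χ) ∧ (∀ χ ∈ s, ∀ i, ‖χ i‖ = 1) ∧
      ∀ m ∈ box N, ∀ n ∈ box N, inner ℂ (v m) (v n) =
        ∑ χ ∈ s, (c χ : ℂ) * ((∏ i, (starRingEnd ℂ) (χ i) ^ m i) * ∏ i, χ i ^ n i) := by
  choose S hS using fun i => exists_shift_isometry hv hspan i (hN i)
  have htop := iSup_iInf_eigenspace_eq_top S (shift_isometries_commute hv hspan hN hS)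
  obtain ⟨f, hf, hf0⟩ := (Submodule.mem_iSup_iff_exists_finsupp _ (v 0)).1
    (htop ▸ Submodule.mem_top : v 0 ∈ _)
  have heig : ∀ χ i, S i (f χ) = χ i • f χ := fun χ i =>
    Module.End.mem_eigenspace_iff.1 ((Submodule.mem_iInf _).1 (hf χ) i)
  have horth : ∀ χ ψ, χ ≠ ψ → inner ℂ (f χ) (f ψ) = 0 := by
    intro χ ψ h
    obtain ⟨i, hi⟩ := Function.ne_iff.1 h
    exact inner_eq_zero_of_eigenvalue_ne (heig χ i) (heig ψ i) hi
  -- Every `v m` is obtained from `v 0` by applying the shifts, one unit step at a time.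
  have hvm : ∀ k : ℕ, ∀ m ∈ box N, ∑ i, m i = k →
      v m = ∑ χ ∈ f.support, (∏ i, χ i ^ m i) • f χ := by
    intro k
    induction k with
    | zero =>
      intro m _ hm
      have hm0 : m = 0 := funext fun i => by simpa using (Finset.sum_eq_zero_iff.1 hm) i
      simpa [hm0, Finsupp.sum] using hf0.symm
    | succ k ih =>
      intro m hm hmk
      obtain ⟨i, hi⟩ : ∃ i, m i ≠ 0 := by
        by_contra! h
        simp [h] at hmk
      obtain ⟨m', rfl⟩ : ∃ m', m = m' + Pi.single i 1 := by
        refine ⟨m - Pi.single i 1, (tsub_add_cancel_of_le fun j => ?_).symm⟩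
        rcases eq_or_ne j i with rfl | hj
        · rw [Pi.single_eq_same]; exact Nat.one_le_iff_ne_zero.2 hi
        · rw [Pi.single_eq_of_ne hj]; exact Nat.zero_le _
      have hsum : ∑ j, m' j = k := by
        simp only [Pi.add_apply, Finset.sum_add_distrib, Finset.sum_pi_single',
          Finset.mem_univ, if_true] at hmk
        simpa using hmk
      rw [← hS i m' hm, ih m' (mem_box_of_add hm) hsum, map_sum]
      refine Finset.sum_congr rfl fun χ _ => ?_
      rw [map_smul, heig, smul_smul]
      simp only [Pi.add_apply, pow_add, Finset.prod_mul_distrib]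
      congr 2
      rw [Finset.prod_eq_single i (fun j _ hj => by simp [hj]) (by simp)]
      simp
  have hli : LinearIndependent ℂ (fun χ : f.support => f χ) :=
    linearIndependent_of_ne_zero_of_inner_eq_zero (fun χ => Finsupp.mem_support_iff.1 χ.2)
      fun χ ψ h => horth _ _ fun h' => h (Subtype.ext h')
  have hsp : ⊤ ≤ Submodule.span ℂ (Set.range fun χ : f.support => f χ) := by
    rw [← hspan, Submodule.span_le]
    rintro _ ⟨m, hm, rfl⟩
    rw [hvm _ m hm rfl]
    exact Submodule.sum_mem _ fun χ hχ =>
      Submodule.smul_mem _ _ (Submodule.subset_span ⟨⟨χ, hχ⟩, rfl⟩)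
  refine ⟨f.support, fun χ => ‖f χ‖ ^ 2, ?_, ?_, ?_, ?_⟩
  · have := Module.finrank_eq_card_basis (Module.Basis.mk hli hsp)
    rw [this, Fintype.card_coe]
  · intro χ hχ
    have := norm_pos_iff.2 (Finsupp.mem_support_iff.1 hχ)
    positivity
  · exact fun χ hχ i => norm_eigenvalue_linearIsometry (Finsupp.mem_support_iff.1 hχ) (heig χ i)
  · intro m hm n hn
    rw [hvm _ m hm rfl, hvm _ n hn rfl, sum_inner]
    refine Finset.sum_congr rfl fun χ hχ => ?_
    rw [inner_sum, Finset.sum_eq_single χ]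
    · rw [inner_smul_left, inner_smul_right, inner_self_eq_norm_sq_to_K, map_prod]
      simp only [map_pow]
      push_cast
      ring_nf
      rfl
    · intro ψ _ h
      rw [inner_smul_left, inner_smul_right, horth _ _ h.symm]
      simp
    · exact fun h => absurd hχ h

end Box

/-! ### Frequencies on the unit circle -/

section Frequencies

/-- Every point of the unit circle is `e^{i2πt}` for some frequency `t ∈ [0,1)`. -/
theorem exists_freq_of_norm_eq_one {z : ℂ} (hz : ‖z‖ = 1) :
    ∃ t ∈ Set.Ico (0 : ℝ) 1, Complex.exp (Complex.I * 2 * Real.pi * t) = z := by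
  obtain ⟨θ, rfl⟩ := (Complex.norm_eq_one_iff z).1 hz
  refine ⟨Int.fract (θ / (2 * Real.pi)), ⟨Int.fract_nonneg _, Int.fract_lt_one _⟩, ?_⟩
  rw [Complex.exp_eq_exp_iff_exists_int]
  refine ⟨-⌊θ / (2 * Real.pi)⌋, ?_⟩
  have hpi : (Real.pi : ℂ) ≠ 0 := by exact_mod_cast Real.pi_ne_zero
  rw [Int.fract]
  push_cast
  field_simp
  ring

theorem freq_eq_of_exp_eq {s t : ℝ} (hs : s ∈ Set.Ico (0 : ℝ) 1) (ht : t ∈ Set.Ico (0 : ℝ) 1)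
    (h : Complex.exp (Complex.I * 2 * Real.pi * s) = Complex.exp (Complex.I * 2 * Real.pi * t)) :
    s = t := by
  obtain ⟨n, hn⟩ := Complex.exp_eq_exp_iff_exists_int.1 h
  have hpi : (Real.pi : ℂ) ≠ 0 := by exact_mod_cast Real.pi_ne_zero
  have h1 : (s : ℂ) = ((t + n : ℝ) : ℂ) := by
    have h2 : (2 * Real.pi * Complex.I) * (s : ℂ) = (2 * Real.pi * Complex.I) * (t + n) := by
      linear_combination hn
    have := mul_left_cancel₀ (mul_ne_zero (mul_ne_zero two_ne_zero hpi) Complex.I_ne_zero) h2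
    rw [this]
    push_cast
    ring
  have h2 : s = t + n := by exact_mod_cast h1
  have h3 : n < 1 := by
    have : (n : ℝ) < 1 := by linarith [hs.2, ht.1]
    exact_mod_cast this
  have h4 : -1 < n := by
    have : (-1 : ℝ) < n := by linarith [hs.1, ht.2]
    exact_mod_cast this
  obtain rfl : n = 0 := by omega
  simpa using h2

end Frequencies

/-! ### Atoms and their combinations -/

section Atoms

variable {d : ℕ}

/-- The character `j ↦ e^{i2π ⟨j, f⟩}` of the lattice `ℤ ^ d` with frequency vector `f`. -/
noncomputable def latticeChar (f : Fin d → ℝ) (j : Fin d → ℤ) : ℂ :=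
  ∏ i, Complex.exp (Complex.I * 2 * Real.pi * (j i) * f i)

theorem latticeChar_sub_single (f : Fin d → ℝ) (j : Fin d → ℤ) (i : Fin d) (k : ℤ) :
    latticeChar f (j - Pi.single i k) =
      Complex.exp (-(Complex.I * 2 * Real.pi * k * f i)) * latticeChar f j := by
  unfold latticeChar
  rw [← Complex.exp_sum, ← Complex.exp_sum, ← Complex.exp_add]
  congr 1
  have : ∑ x, Complex.I * 2 * Real.pi * ((Pi.single i k : Fin d → ℤ) x) * f x =
      Complex.I * 2 * Real.pi * k * f i := by
    rw [Finset.sum_eq_single i (fun x _ hx => by simp [hx]) (by simp)]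
    simp
  rw [← this, ← Finset.sum_neg_distrib, ← Finset.sum_add_distrib]
  refine Finset.sum_congr rfl fun x _ => ?_
  simp only [Pi.sub_apply]
  push_cast
  ring

theorem atom_mul_star_atom (N : Fin d → ℕ) (f : Fin d → ℝ) (m n : Idx N) :
    Matrix.vecMulVec (atom N f) (star (atom N f)) m n = latticeChar f (lag m n) := by
  simp only [Matrix.vecMulVec_apply, Pi.star_apply, atom, sinusoid, latticeChar, lag, star_prod]
  rw [← Finset.prod_mul_distrib]
  refine Finset.prod_congr rfl fun i _ => ?_
  rw [Complex.star_def, ← Complex.exp_conj, ← Complex.exp_add]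
  simp only [map_mul, Complex.conj_I, Complex.conj_ofReal, map_natCast, map_ofNat]
  congr 1
  push_cast
  ring

theorem atom_eq_prod_pow (N : Fin d → ℕ) (f : Fin d → ℝ) (m : Idx N) :
    atom N f m = ∏ i, Complex.exp (Complex.I * 2 * Real.pi * f i) ^ (m i : ℕ) := by
  unfold atom sinusoid
  refine Finset.prod_congr rfl fun i _ => ?_
  rw [← Complex.exp_nat_mul]
  congr 1
  ring

/-- Every integer vector with `|j i| < N i` is the lag of two multi-indices, so the decomposition of
the block Toeplitz matrix determines all relevant entries of `B`. -/
theorem exists_lag_eq {N : Fin d → ℕ} {j : Fin d → ℤ} (hj : ∀ i, |j i| < N i) :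
    ∃ m n : Idx N, lag m n = j := by
  refine ⟨fun i => ⟨(j i).toNat, ?_⟩, fun i => ⟨(-j i).toNat, ?_⟩, funext fun i => ?_⟩
  · have := hj i
    rw [abs_lt] at this
    omega
  · have := hj i
    rw [abs_lt] at this
    omega
  · simp only [lag]
    omega

/-- For at most `min N i` distinct frequency vectors there is a vector that pairs to `1` with one
of the atoms and to `0` with the others. Its entries are the coefficients of the product over `i`
of the univariate polynomials vanishing at those `i`-th coordinates that differ from the
distinguished one. -/
theorem exists_dual_vector {N : Fin d → ℕ} {r : ℕ} {f : Fin r → Fin d → ℝ}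
    (hf : Function.Injective f) (hfm : ∀ l i, f l i ∈ Set.Ico (0 : ℝ) 1) (hr : ∀ i, r ≤ N i)
    (l₀ : Fin r) :
    ∃ x : Idx N → ℂ, ∀ l, ∑ m, x m * atom N (f l) m = if l = l₀ then 1 else 0 := by
  classical
  let z : Fin r → Fin d → ℂ := fun l i => Complex.exp (Complex.I * 2 * Real.pi * f l i)
  have hz : ∀ l, l ≠ l₀ → ∃ i, z l i ≠ z l₀ i := by
    intro l hl
    by_contra! h
    exact hl (hf (funext fun i => freq_eq_of_exp_eq (hfm l i) (hfm l₀ i) (h i)))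
  let s : Fin d → Finset (Fin r) := fun i => Finset.univ.filter fun l => z l i ≠ z l₀ i
  let p : Fin d → Polynomial ℂ := fun i => ∏ l ∈ s i, Lagrange.basisDivisor (z l₀ i) (z l i)
  have hdeg : ∀ i, (p i).natDegree < N i := by
    intro i
    have h1 : (p i).natDegree ≤ (s i).card := by
      refine (Polynomial.natDegree_prod_le _ _).trans ?_
      rw [Finset.card_eq_sum_ones]
      refine Finset.sum_le_sum fun l hl => ?_
      exact (Lagrange.natDegree_basisDivisor_of_ne (Finset.mem_filter.1 hl).2.symm).le
    have h2 : (s i).card < r := by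
      have : s i ⊂ Finset.univ := Finset.ssubset_univ_iff.2 fun h => by
        have := h ▸ Finset.mem_univ l₀
        simp [s] at this
      simpa using Finset.card_lt_card this
    exact (h1.trans_lt h2).trans_le (hr i)
  refine ⟨fun m => ∏ i, (p i).coeff (m i), fun l => ?_⟩
  have hsum : ∑ m : Idx N, (∏ i, (p i).coeff (m i)) * atom N (f l) m =
      ∏ i, (p i).eval (z l i) := by
    have : ∀ i, (p i).eval (z l i) = ∑ k : Fin (N i), (p i).coeff k * z l i ^ (k : ℕ) := by
      intro i
      rw [Polynomial.eval_eq_sum_range' (hdeg i), Finset.sum_range]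
    simp only [this]
    rw [Finset.prod_univ_sum, Fintype.piFinset_univ]
    refine Finset.sum_congr rfl fun m _ => ?_
    rw [atom_eq_prod_pow, Finset.prod_mul_distrib]
  rw [hsum]
  split_ifs with h
  · subst h
    refine Finset.prod_eq_one fun i _ => ?_
    rw [Polynomial.eval_prod]
    refine Finset.prod_eq_one fun l' hl' => ?_
    exact Lagrange.eval_basisDivisor_left_of_ne (Finset.mem_filter.1 hl').2.symm
  · obtain ⟨i, hi⟩ := hz l h
    refine Finset.prod_eq_zero (Finset.mem_univ i) ?_
    rw [Polynomial.eval_prod]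
    exact Finset.prod_eq_zero (Finset.mem_filter.2 ⟨Finset.mem_univ l, hi⟩)
      Lagrange.eval_basisDivisor_right

theorem posSemidef_sum_of_nonneg (N : Fin d → ℕ) {r : ℕ} (f : Fin r → Fin d → ℝ)
    {w : Fin r → ℝ} (hw : ∀ l, 0 ≤ w l) :
    (∑ l, (w l : ℂ) • Matrix.vecMulVec (atom N (f l)) (star (atom N (f l)))).PosSemidef :=
  Matrix.posSemidef_sum _ fun l _ =>
    (Matrix.posSemidef_vecMulVec_self_star _).smul (by exact_mod_cast hw l)

/-- The weights of a positive semidefinite combination of at most `min N i` distinct atoms are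
nonnegative: test the matrix against the dual vectors of the atoms. -/
theorem nonneg_of_posSemidef_sum {N : Fin d → ℕ} {r : ℕ} {f : Fin r → Fin d → ℝ}
    (hf : Function.Injective f) (hfm : ∀ l i, f l i ∈ Set.Ico (0 : ℝ) 1) (hr : ∀ i, r ≤ N i)
    {w : Fin r → ℝ}
    (hT : (∑ l, (w l : ℂ) •
      Matrix.vecMulVec (atom N (f l)) (star (atom N (f l)))).PosSemidef) (l₀ : Fin r) :
    0 ≤ w l₀ := by
  obtain ⟨x, hx⟩ := exists_dual_vector hf hfm hr l₀
  have hx' : ∀ l, x ⬝ᵥ atom N (f l) = if l = l₀ then 1 else 0 := hx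
  have h := hT.dotProduct_mulVec_nonneg (star x)
  have key : star (star x) ⬝ᵥ ((∑ l, (w l : ℂ) •
      Matrix.vecMulVec (atom N (f l)) (star (atom N (f l)))).mulVec (star x)) = (w l₀ : ℂ) := by
    rw [star_star, Matrix.sum_mulVec, dotProduct_sum, Finset.sum_eq_single l₀]
    · rw [Matrix.smul_mulVec, Matrix.vecMulVec_mulVec, dotProduct_smul]
      rw [Matrix.star_dotProduct_star]
      simp [hx']
    · intro l _ hl
      rw [Matrix.smul_mulVec, Matrix.vecMulVec_mulVec, dotProduct_smul]
      simp [hx', hl]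
    · simp
  rw [key] at h
  exact_mod_cast h

end Atoms

/-! ### Trigonometric polynomials and the derived Toeplitz matrices -/

section TrigPoly

/-- The value `g(e^{i2πt})` of a Hermitian trigonometric polynomial of degree one, as a real number:
the terms `r₁ x⁻¹` and `conj r₁ x` are conjugate on the unit circle. -/
noncomputable def HermitianTrigPoly.value (g : HermitianTrigPoly) (t : ℝ) : ℝ :=
  g.r0 + 2 * (g.r1 * Complex.exp (-(Complex.I * 2 * Real.pi * t))).re

theorem HermitianTrigPoly.sum_coeff_mul_exp (g : HermitianTrigPoly) (t : ℝ) :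
    ∑ k ∈ Finset.Icc (-1 : ℤ) 1, g.coeff k * Complex.exp (-(Complex.I * 2 * Real.pi * k * t)) =
      (g.value t : ℂ) := by
  have hIcc : Finset.Icc (-1 : ℤ) 1 = {-1, 0, 1} := by decide
  have hc : Complex.exp (Complex.I * 2 * Real.pi * t) =
      (starRingEnd ℂ) (Complex.exp (-(Complex.I * 2 * Real.pi * t))) := by
    rw [← Complex.exp_conj]
    simp only [map_mul, map_neg, Complex.conj_I, Complex.conj_ofReal, map_ofNat]
    congr 1
    ring
  rw [hIcc, Finset.sum_insert (by decide), Finset.sum_insert (by decide), Finset.sum_singleton]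
  have h1 : g.coeff (-1) = (starRingEnd ℂ) g.r1 := by simp [coeff]
  have h2 : g.coeff 0 = g.r0 := by simp [coeff]
  have h3 : g.coeff 1 = g.r1 := by simp [coeff]
  rw [h1, h2, h3, value]
  have h4 : -(Complex.I * 2 * Real.pi * ((-1 : ℤ) : ℂ) * t) = Complex.I * 2 * Real.pi * t := by
    push_cast
    ring
  have h5 := Complex.add_conj (g.r1 * Complex.exp (-(Complex.I * 2 * Real.pi * t)))
  rw [h4, hc]
  rw [map_mul] at h5
  push_cast at h5 ⊢
  rw [← h5]
  simp only [mul_zero, zero_mul, neg_zero, Complex.exp_zero, mul_one]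
  ring

/-- The value in product form, which exhibits the endpoints of the interval as its zeros. -/
theorem intervalPoly_value (fL fH t : ℝ) :
    (intervalPoly fL fH).value t = 4 * Real.sign (fH - fL) *
      (Real.sin (Real.pi * (fH - t)) * Real.sin (Real.pi * (t - fL))) := by
  have h : (intervalPoly fL fH).r1 * Complex.exp (-(Complex.I * 2 * Real.pi * t)) =
      (Real.sign (fH - fL) : ℂ) *
        Complex.exp ((Real.pi * (fL + fH - 2 * t) : ℝ) * Complex.I) := by
    simp only [intervalPoly]
    rw [mul_right_comm, ← Complex.exp_add, mul_comm]
    congr 2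
    push_cast
    ring
  rw [HermitianTrigPoly.value, h, Complex.re_ofReal_mul, Complex.exp_ofReal_mul_I_re]
  have e1 : Real.pi * (fL + fH - 2 * t) = Real.pi * (fH - t) - Real.pi * (t - fL) := by ring
  have e2 : Real.pi * (fH - fL) = Real.pi * (fH - t) + Real.pi * (t - fL) := by ring
  simp only [intervalPoly]
  rw [e1, e2, Real.cos_add, Real.cos_sub]
  ring

theorem exists_pos_sin_pi_mul_eq {x : ℝ} (h1 : -1 < x) (h2 : x < 1) :
    ∃ p > 0, Real.sin (Real.pi * x) = p * x := by
  have hpi := Real.pi_pos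
  rcases lt_trichotomy x 0 with h | rfl | h
  · refine ⟨Real.sin (Real.pi * x) / x, div_pos_of_neg_of_neg ?_ h, (div_mul_cancel₀ _ h.ne).symm⟩
    exact Real.sin_neg_of_neg_of_neg_pi_lt (by nlinarith) (by nlinarith)
  · exact ⟨1, one_pos, by simp⟩
  · refine ⟨Real.sin (Real.pi * x) / x, div_pos ?_ h, (div_mul_cancel₀ _ h.ne').symm⟩
    exact Real.sin_pos_of_pos_of_lt_pi (by positivity) (by nlinarith)

/-- The polynomial attached to a frequency interval is nonnegative exactly on that interval. In the
factorised form of its value each `sin (π x)` has the sign of `x`, because `|x| < 1`. -/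
theorem intervalPoly_value_nonneg_iff {fL fH t : ℝ} (hL : fL ∈ Set.Ico (0 : ℝ) 1)
    (hH : fH ∈ Set.Ico (0 : ℝ) 1) (ht : t ∈ Set.Ico (0 : ℝ) 1) :
    0 ≤ (intervalPoly fL fH).value t ↔ t ∈ freqInterval fL fH := by
  obtain ⟨p, hp, hp'⟩ := exists_pos_sin_pi_mul_eq (x := fH - t)
    (by linarith [hH.1, ht.2]) (by linarith [hH.2, ht.1])
  obtain ⟨q, hq, hq'⟩ := exists_pos_sin_pi_mul_eq (x := t - fL)
    (by linarith [ht.1, hL.2]) (by linarith [ht.2, hL.1])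
  have hpq : 0 < 4 * (p * q) := by positivity
  rw [intervalPoly_value, hp', hq', freqInterval]
  have e : 4 * Real.sign (fH - fL) * (p * (fH - t) * (q * (t - fL))) =
      4 * (p * q) * (Real.sign (fH - fL) * ((fH - t) * (t - fL))) := by ring
  rw [e, mul_nonneg_iff_of_pos_left hpq]
  rcases lt_trichotomy fL fH with h | h | h
  · rw [if_pos h, Real.sign_of_pos (sub_pos.2 h), one_mul, Set.mem_Icc]
    constructor
    · intro h0
      by_contra hne
      rcases lt_or_ge t fL with h1 | h1
      · nlinarith
      · have : fH < t := by
          by_contra! h2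
          exact hne ⟨h1, h2⟩
        nlinarith
    · rintro ⟨h1, h2⟩
      exact mul_nonneg (sub_nonneg.2 h2) (sub_nonneg.2 h1)
  · subst h
    simpa using ht
  · rw [if_neg h.not_gt, Real.sign_of_neg (sub_neg.2 h)]
    simp only [Set.mem_sdiff, ht, true_and, Set.mem_Ioo, not_and, not_lt]
    constructor
    · intro h0 h1
      nlinarith
    · intro h0
      rcases le_or_gt t fH with h1 | h1
      · nlinarith
      · nlinarith [h0 h1]

/-- Passing from `B` to the derived Toeplitz matrix multiplies the weight of each atom by the value
of the polynomial at its `i`-th frequency. -/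
theorem derivedToeplitz_eq_sum {d : ℕ} {N : Fin d → ℕ} {B : (Fin d → ℤ) → ℂ} {r : ℕ}
    {σ : Fin r → ℝ} {f : Fin r → Fin d → ℝ}
    (h : IsVandermondeDecomposition N (blockToeplitz N B) σ f) (g : HermitianTrigPoly)
    (i : Fin d) :
    derivedToeplitz N B g i = ∑ l, ((σ l * g.value (f l i) : ℝ) : ℂ) •
      Matrix.vecMulVec (atom (fun j => N j - 1) (f l))
        (star (atom (fun j => N j - 1) (f l))) := by
  have hB : ∀ j : Fin d → ℤ, (∀ i, |j i| < N i) →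
      B j = ∑ l, (σ l : ℂ) * latticeChar (f l) j := by
    intro j hj
    obtain ⟨m, n, rfl⟩ := exists_lag_eq hj
    have := congrFun (congrFun h.eq_sum m) n
    simpa [blockToeplitz, Matrix.sum_apply, atom_mul_star_atom] using this
  ext m n
  have hlag : ∀ k ∈ Finset.Icc (-1 : ℤ) 1,
      B (lag m n - Pi.single i k) = ∑ l, (σ l : ℂ) *
        (Complex.exp (-(Complex.I * 2 * Real.pi * k * f l i)) * latticeChar (f l) (lag m n)) := by
    intro k hk
    rw [hB]
    · simp only [latticeChar_sub_single]
    · intro j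
      have hm : (m j : ℕ) < N j - 1 := (m j).2
      have hn : (n j : ℕ) < N j - 1 := (n j).2
      rw [Finset.mem_Icc] at hk
      rw [abs_lt]
      simp only [Pi.sub_apply, lag]
      rcases eq_or_ne j i with rfl | hj
      · rw [Pi.single_eq_same]
        omega
      · rw [Pi.single_eq_of_ne hj]
        omega
  simp only [derivedToeplitz, Matrix.of_apply, Matrix.sum_apply, Matrix.smul_apply,
    atom_mul_star_atom, smul_eq_mul]
  rw [Finset.sum_congr rfl fun k hk => by rw [hlag k hk, Finset.mul_sum], Finset.sum_comm]
  refine Finset.sum_congr rfl fun l _ => ?_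
  rw [Complex.ofReal_mul, ← g.sum_coeff_mul_exp, Finset.mul_sum, Finset.sum_mul]
  refine Finset.sum_congr rfl fun k _ => ?_
  ring

end TrigPoly

/-! ### The Vandermonde decomposition -/

section Decomposition

variable {d : ℕ}

/-- A positive semidefinite matrix is the Gram matrix of vectors spanning a space whose dimension
is the rank. -/
theorem exists_gram_of_posSemidef {ι : Type*} [Fintype ι] [DecidableEq ι] {T : Matrix ι ι ℂ}
    (hT : T.PosSemidef) :
    ∃ u : ι → EuclideanSpace ℂ ι, (∀ m n, inner ℂ (u m) (u n) = T m n) ∧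
      Module.finrank ℂ (Submodule.span ℂ (Set.range u)) = T.rank := by
  obtain ⟨C, rfl⟩ : ∃ C : Matrix ι ι ℂ, T = C.conjTranspose * C := by
    open scoped MatrixOrder Matrix.Norms.L2Operator in
    exact CStarAlgebra.nonneg_iff_eq_star_mul_self.1 hT.nonneg
  let e := (WithLp.linearEquiv 2 ℂ (ι → ℂ)).symm
  refine ⟨fun m => e (C.col m), fun m n => ?_, ?_⟩
  · simp [e, EuclideanSpace.inner_eq_star_dotProduct, Matrix.mul_apply, dotProduct, mul_comm]
  · rw [Matrix.rank_conjTranspose_mul_self, Matrix.rank_eq_finrank_span_cols,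
      ← LinearEquiv.finrank_map_eq e (Submodule.span ℂ (Set.range C.col)), Submodule.map_span,
      ← Set.range_comp]
    rfl

/-- A positive semidefinite multilevel Toeplitz matrix whose rank is smaller than each `N i` has a
Vandermonde decomposition with as many atoms as its rank. -/
theorem exists_vandermondeDecomposition {N : Fin d → ℕ} {B : (Fin d → ℤ) → ℂ} {r : ℕ}
    (hr : (blockToeplitz N B).rank = r) (hrN : ∀ i, r < N i)
    (hT : (blockToeplitz N B).PosSemidef) :
    ∃ (σ : Fin r → ℝ) (f : Fin r → Fin d → ℝ),
      IsVandermondeDecomposition N (blockToeplitz N B) σ f := by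
  classical
  obtain ⟨u, hu, hrank⟩ := exists_gram_of_posSemidef hT
  rw [hr] at hrank
  let V := Submodule.span ℂ (Set.range u)
  let toIdx : ∀ m : Fin d → ℕ, m ∈ box N → Idx N := fun m hm i => ⟨m i, hm i⟩
  let v : (Fin d → ℕ) → V := fun m => if hm : m ∈ box N then
    ⟨u (toIdx m hm), Submodule.subset_span ⟨_, rfl⟩⟩ else 0
  have hvB : ∀ m ∈ box N, ∀ n ∈ box N,
      inner ℂ (v m) (v n) = B fun i => (m i : ℤ) - (n i : ℤ) := by
    intro m hm n hn
    simp only [v, dif_pos hm, dif_pos hn, Submodule.coe_inner, hu]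
    rfl
  have hshift : ShiftInvariantGram N v := by
    intro i m n hm hn
    rw [hvB _ hm _ hn, hvB _ (mem_box_of_add hm) _ (mem_box_of_add hn)]
    congr 1
    ext j
    simp
  have hspan : Submodule.span ℂ (v '' box N) = ⊤ := by
    rw [eq_top_iff, ← Submodule.span_span_coe_preimage (R := ℂ) (s := Set.range u)]
    refine Submodule.span_mono ?_
    rintro ⟨_, he⟩ ⟨m, rfl⟩
    refine ⟨fun i => m i, fun i => (m i).2, ?_⟩
    simp only [v]
    rw [dif_pos (show (fun i => (m i : ℕ)) ∈ box N from fun i => (m i).2)]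
  obtain ⟨s, c, hs, hc, hχ, hdec⟩ := exists_character_decomposition hshift hspan
    (fun i => hrank.trans_lt (hrN i))
  rw [hrank] at hs
  -- The inner product is conjugate-linear on the left, so the atoms carry the conjugates of the
  -- characters.
  have hfreq : ∀ χ : s, ∀ i, ∃ t ∈ Set.Ico (0 : ℝ) 1,
      Complex.exp (Complex.I * 2 * Real.pi * t) = (starRingEnd ℂ) (χ.1 i) := fun χ i =>
    exists_freq_of_norm_eq_one (by rw [RCLike.norm_conj, hχ χ.1 χ.2 i])
  choose F hF01 hF using hfreq
  let e : Fin r ≃ s := (s.equivFinOfCardEq hs).symm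
  refine ⟨fun l => c (e l), fun l => F (e l), fun l => hc _ (e l).2, fun l i => hF01 _ _, ?_, ?_⟩
  · intro l l' h
    refine e.injective (Subtype.ext (funext fun i => ?_))
    have := hF (e l) i
    rw [show F (e l) i = F (e l') i from congrFun h i, hF] at this
    exact ((starRingEnd ℂ).injective this).symm
  · ext m n
    have h := hdec (fun i => m i) (fun i => (m i).2) (fun i => n i) (fun i => (n i).2)
    rw [hvB _ (fun i => (m i).2) _ (fun i => (n i).2), ← Finset.sum_coe_sort, ← e.sum_comp] at h
    simp only [Matrix.sum_apply, Matrix.smul_apply, smul_eq_mul, Matrix.vecMulVec_apply,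
      Pi.star_apply, atom_eq_prod_pow, hF, star_prod, star_pow, Complex.star_def, Complex.conj_conj]
    exact h

end Decomposition

end MDFS

theorem proposition1 {d : ℕ} (hd : 2 ≤ d) (N : Fin d → ℕ) (B : (Fin d → ℤ) → ℂ)
    (r : ℕ) (hr : (MDFS.blockToeplitz N B).rank = r) (hrN : ∀ i, r < N i)
    (fL fH : Fin d → ℝ)
    (hL : ∀ i, fL i ∈ Set.Ico (0 : ℝ) 1) (hH : ∀ i, fH i ∈ Set.Ico (0 : ℝ) 1) :
    (∃ (σ : Fin r → ℝ) (f : Fin r → Fin d → ℝ),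
        MDFS.IsVandermondeDecomposition N (MDFS.blockToeplitz N B) σ f ∧
          ∀ l i, f l i ∈ MDFS.freqInterval (fL i) (fH i)) ↔
      (MDFS.blockToeplitz N B).PosSemidef ∧
        ∀ i, (MDFS.derivedToeplitz N B (MDFS.intervalPoly (fL i) (fH i)) i).PosSemidef := by
  constructor
  · rintro ⟨σ, f, h, hf⟩
    refine ⟨h.eq_sum ▸ MDFS.posSemidef_sum_of_nonneg N f fun l => (h.pos l).le, fun i => ?_⟩
    rw [MDFS.derivedToeplitz_eq_sum h]
    exact MDFS.posSemidef_sum_of_nonneg _ f fun l => mul_nonneg (h.pos l).le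
      ((MDFS.intervalPoly_value_nonneg_iff (hL i) (hH i) (h.mem_unit l i)).2 (hf l i))
  · rintro ⟨hT, hTg⟩
    obtain ⟨σ, f, h⟩ := MDFS.exists_vandermondeDecomposition hr hrN hT
    refine ⟨σ, f, h, fun l i => ?_⟩
    have hi := hTg i
    rw [MDFS.derivedToeplitz_eq_sum h] at hi
    have hw := MDFS.nonneg_of_posSemidef_sum h.distinct h.mem_unit
      (fun j => Nat.le_sub_one_of_lt (hrN j)) hi l
    exact (MDFS.intervalPoly_value_nonneg_iff (hL i) (hH i) (h.mem_unit l i)).1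
      ((mul_nonneg_iff_of_pos_left (h.pos l)).1 hw)
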